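/- \textbf{Theorem 1.} For all real numbers $R>0$ and $\rho>0$ there is $\varepsilon>0$, depending only on $R$ and $\rho$, with the following property. Let $\Gamma$ be a group of isometries of $\mathbb H^3$ acting freely and properly discontinuously, let $x\in\mathbb H^3$, and let $D=\{y : d(x,y)\le d(gx,y)\ \text{for all}\ g\in\Gamma,\ g\ne 1\}$ be the Dirichlet domain of $\Gamma$ centred at $x$. Suppose that the manifold $\mathbb H^3/\Gamma$ has finite volume, that is, $\operatorname{vol}(D)<\infty$, and that the injectivity radius $\tfrac12\inf_{1\ne g\in\Gamma}d(x,gx)$ of $D$ is at least $\rho$. For a finite set $S\subset\Gamma$ and $y\in\mathbb H^3$ put $D'_y=\bigcap_{g\in S}\{z : d(y,z)\le d(gy,z)\}$. An element $s\in S$, $s\neq 1$, is called a face element of $D'_y$ if $D'_y$ contains a nonempty relatively open subset of the plane $\{z : d(y,z)=d(sy,z)\}$; the part of $D'_y$ in this plane is then the face of $s$. An edge of $D'_y$ is the intersection of two different faces, if it has more than one point. The spine radius of $D'_y$ is the maximum, over all edges $E$ of $D'_y$, of the distance from $y$ to $E$. Let $D'=D'_x\supseteq D$ be an approximate Dirichlet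 domain of $\Gamma$, that is, assume that $\Gamma$ has a generating set $T$ such that $t$ and $t^{-1}$ are face elements of $D'$ for all $t\in T$. Assume that \[ \operatorname{vol}(D')-\operatorname{vol}(D)<\varepsilon \] and that $x$ is a local minimum of the function that sends $y$ to the spine radius of $D'_y$. Then every translate of $D$ in the ball $B(x,R)$ is obtained from translates of $D'$ by adding neighbours across faces, starting from $D'$ and without leaving the ball: for every $g\in\Gamma$ with $gx\in B(x,R)$ there are $n\ge 0$ and face elements $s_1,\dots,s_n$ of $D'$ such that $g=s_1s_2\cdots s_n$ and $s_1\cdots s_i\,x\in B(x,R)$ for all $i\le n$. -/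

import Mathlib

open scoped ENNReal

/-- Hyperbolic 3-space in the hyperboloid model: the point with spatial coordinates `u ∈ ℝ³` is
the point `(√(1 + |u|²), u)` of the upper sheet `-t² + |u|² = -1`, `t > 0`. -/
@[ext]
structure HypSpace3 where
  /-- the spatial coordinates -/
  coord : EuclideanSpace ℝ (Fin 3)

namespace HypSpace3

noncomputable section

/-- The time coordinate of a point of the hyperboloid. -/
def time (p : HypSpace3) : ℝ := √(1 + ‖p.coord‖ ^ 2)

/-- Minus the Lorentz product of two points of the hyperboloid. -/
def lorentz (p q : HypSpace3) : ℝ := p.time * q.time - inner ℝ p.coord q.coord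

/-- The hyperbolic distance: `cosh d(p, q)` is minus the Lorentz product. -/
instance : Dist HypSpace3 := ⟨fun p q => Real.arcosh (lorentz p q)⟩

theorem dist_def (p q : HypSpace3) : dist p q = Real.arcosh (lorentz p q) := rfl

theorem time_sq (p : HypSpace3) : p.time ^ 2 = 1 + ‖p.coord‖ ^ 2 :=
  Real.sq_sqrt (by positivity)

theorem time_pos (p : HypSpace3) : 0 < p.time := Real.sqrt_pos.2 (by positivity)

theorem lorentz_self (p : HypSpace3) : lorentz p p = 1 := by
  have := time_sq p
  simp only [lorentz, real_inner_self_eq_norm_sq]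
  nlinarith

theorem lorentz_comm (p q : HypSpace3) : lorentz p q = lorentz q p := by
  simp only [lorentz, real_inner_comm]
  ring

theorem one_le_lorentz (p q : HypSpace3) : 1 ≤ lorentz p q := by
  have h1 := real_inner_le_norm p.coord q.coord
  have h2 : 1 + ‖p.coord‖ * ‖q.coord‖ ≤ p.time * q.time := by
    refine abs_le_of_sq_le_sq' ?_ (mul_pos (time_pos p) (time_pos q)).le |>.2
    rw [mul_pow, time_sq, time_sq]
    nlinarith [sq_nonneg (‖p.coord‖ - ‖q.coord‖)]
  unfold lorentz
  linarith

theorem eq_of_lorentz_eq_one {p q : HypSpace3} (h : lorentz p q = 1) : p = q := by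
  have h1 : p.time * q.time = 1 + inner ℝ p.coord q.coord := by
    unfold lorentz at h
    linarith
  have h2 : (1 + ‖p.coord‖ ^ 2) * (1 + ‖q.coord‖ ^ 2) = (1 + inner ℝ p.coord q.coord) ^ 2 := by
    rw [← h1, mul_pow, time_sq, time_sq]
  have h3 : inner ℝ p.coord q.coord ^ 2 ≤ (‖p.coord‖ * ‖q.coord‖) ^ 2 :=
    sq_le_sq' (neg_le_of_abs_le (abs_real_inner_le_norm _ _)) (real_inner_le_norm _ _)
  have h4 : ‖p.coord - q.coord‖ ^ 2 ≤ 0 := by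
    rw [norm_sub_sq_real]
    nlinarith
  have h5 : ‖p.coord - q.coord‖ = 0 := by nlinarith [norm_nonneg (p.coord - q.coord)]
  exact HypSpace3.ext (sub_eq_zero.1 (norm_eq_zero.1 h5))

/-- The Lorentz form is nonnegative on the orthogonal complement of a point. -/
theorem sq_le_of_orthogonal (v : HypSpace3) (Z : EuclideanSpace ℝ (Fin 3)) (z : ℝ)
    (h : inner ℝ Z v.coord = z * v.time) : z ^ 2 ≤ ‖Z‖ ^ 2 := by
  have h1 : inner ℝ Z v.coord ^ 2 ≤ (‖Z‖ * ‖v.coord‖) ^ 2 :=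
    sq_le_sq' (neg_le_of_abs_le (abs_real_inner_le_norm _ _)) (real_inner_le_norm _ _)
  rw [h, mul_pow, mul_pow, time_sq] at h1
  by_contra hc
  push Not at hc
  nlinarith [sq_nonneg ‖v.coord‖, sq_nonneg ‖Z‖,
    mul_nonneg (sub_nonneg.2 hc.le) (sq_nonneg ‖v.coord‖)]

theorem gram (u v w : HypSpace3) :
    (lorentz u w - lorentz u v * lorentz v w) ^ 2
      ≤ (lorentz u v ^ 2 - 1) * (lorentz v w ^ 2 - 1) := by
  have key : ∀ t : ℝ, 0 ≤ (lorentz u v ^ 2 - 1) * (t * t)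
      + (2 * (lorentz u v * lorentz v w - lorentz u w)) * t + (lorentz v w ^ 2 - 1) := by
    intro t
    have hu := time_sq u
    have hv := time_sq v
    have hw := time_sq w
    set m := t * lorentz u v + lorentz v w with hm
    have h := sq_le_of_orthogonal v (t • u.coord + w.coord - m • v.coord)
      (t * u.time + w.time - m * v.time) (by
        rw [hm]
        simp only [lorentz, inner_add_left, inner_sub_left, inner_smul_left,
          real_inner_self_eq_norm_sq]
        rw [real_inner_comm v.coord w.coord]
        simp
        linear_combination (t * (u.time * v.time - inner ℝ u.coord v.coord)
          + (v.time * w.time - inner ℝ v.coord w.coord)) * hv)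
    have e : ‖t • u.coord + w.coord - m • v.coord‖ ^ 2
        = t ^ 2 * ‖u.coord‖ ^ 2 + ‖w.coord‖ ^ 2 + m ^ 2 * ‖v.coord‖ ^ 2
          + 2 * t * inner ℝ u.coord w.coord - 2 * t * m * inner ℝ u.coord v.coord
          - 2 * m * inner ℝ v.coord w.coord := by
      simp only [← real_inner_self_eq_norm_sq, inner_add_left, inner_sub_left, inner_smul_left,
        inner_add_right, inner_sub_right, inner_smul_right, real_inner_comm u.coord w.coord,
        real_inner_comm u.coord v.coord, real_inner_comm w.coord v.coord]
      simp
      ring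
    rw [e] at h
    have h' := sub_nonneg.2 h
    refine h'.trans_eq ?_
    rw [hm]
    simp only [lorentz]
    linear_combination (-t ^ 2) * hu - hw
      - (t * (u.time * v.time - inner ℝ u.coord v.coord)
          + (v.time * w.time - inner ℝ v.coord w.coord)) ^ 2 * hv
  have := discrim_le_zero key
  unfold discrim at this
  nlinarith

theorem dist_triangle' (u v w : HypSpace3) : dist u w ≤ dist u v + dist v w := by
  have ha := one_le_lorentz u v
  have hb := one_le_lorentz v w
  have hc := one_le_lorentz u w
  have hsum : 0 ≤ dist u v + dist v w :=
    add_nonneg (Real.arcosh_nonneg ha) (Real.arcosh_nonneg hb)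
  rw [← Real.arcosh_cosh hsum, dist_def u w,
    Real.arcosh_le_arcosh (by linarith) (Real.cosh_pos _), Real.cosh_add, dist_def, dist_def,
    Real.cosh_arcosh ha, Real.cosh_arcosh hb, Real.sinh_arcosh ha, Real.sinh_arcosh hb,
    ← Real.sqrt_mul (by nlinarith)]
  have := Real.le_sqrt_of_sq_le (gram u v w)
  linarith

instance : MetricSpace HypSpace3 where
  dist_self p := by rw [dist_def, lorentz_self, Real.arcosh_zero]
  dist_comm p q := by rw [dist_def, dist_def, lorentz_comm]
  dist_triangle := dist_triangle'
  eq_of_dist_eq_zero {p q} h :=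
    eq_of_lorentz_eq_one ((Real.arcosh_eq_zero_iff (one_le_lorentz p q)).1 h)

/-- Hyperbolic volume; in the coordinates `u` the volume form is `du / √(1 + |u|²)`. -/
def hvol (A : Set HypSpace3) : ℝ≥0∞ :=
  ∫⁻ u in {u : EuclideanSpace ℝ (Fin 3) | HypSpace3.mk u ∈ A},
    ENNReal.ofReal (1 / √(1 + ‖u‖ ^ 2))

/-- `Γ` acts freely and properly discontinuously, so `ℍ³ / Γ` is a hyperbolic 3-manifold with
fundamental group `Γ`. -/
structure IsManifoldGroup (Γ : Subgroup (HypSpace3 ≃ᵢ HypSpace3)) : Prop where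
  free : ∀ g ∈ Γ, ∀ p : HypSpace3, g p = p → g = 1
  properlyDiscontinuous : ∀ K : Set HypSpace3, IsCompact K →
    {g : HypSpace3 ≃ᵢ HypSpace3 | g ∈ Γ ∧ (g '' K ∩ K).Nonempty}.Finite

/-- The Dirichlet domain of `Γ` centred at `x`. -/
def dirichletDomain (Γ : Subgroup (HypSpace3 ≃ᵢ HypSpace3)) (x : HypSpace3) : Set HypSpace3 :=
  {y | ∀ g ∈ Γ, g ≠ 1 → dist x y ≤ dist (g x) y}

/-- The injectivity radius at the basepoint: half of the least displacement of `x`, which is the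
radius of the largest ball about `x` inscribed in the Dirichlet domain. -/
def injRadius (Γ : Subgroup (HypSpace3 ≃ᵢ HypSpace3)) (x : HypSpace3) : ℝ :=
  sInf {d : ℝ | ∃ g ∈ Γ, g ≠ 1 ∧ d = dist x (g x)} / 2

/-- The polyhedron centred at `x` cut out by the half-spaces `H_g = {y | d(x, y) ≤ d(g x, y)}`
of finitely many `g`. -/
def polyhedron (S : Finset (HypSpace3 ≃ᵢ HypSpace3)) (x : HypSpace3) : Set HypSpace3 :=
  {y | ∀ g ∈ S, dist x y ≤ dist (g x) y}

/-- The plane of points equidistant from `x` and `g x`, the boundary of `H_g`. -/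
def wallPlane (x : HypSpace3) (g : HypSpace3 ≃ᵢ HypSpace3) : Set HypSpace3 :=
  {y | dist x y = dist (g x) y}

/-- `g` corresponds to a (two-dimensional) face of the polyhedron: the half-space of `g` was used,
and the polyhedron contains a nonempty relatively open piece of the plane bounding it. -/
def IsFaceElement (S : Finset (HypSpace3 ≃ᵢ HypSpace3)) (x : HypSpace3)
    (g : HypSpace3 ≃ᵢ HypSpace3) : Prop :=
  g ∈ S ∧ g ≠ 1 ∧ ∃ p ∈ wallPlane x g, ∃ δ > 0,
    Metric.ball p δ ∩ wallPlane x g ⊆ polyhedron S x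

/-- The polyhedron of `S` centred at `x` is an approximate Dirichlet domain of `Γ`: finitely many
elements of `Γ` have been used, and there is a generating set of `Γ` all of whose elements,
together with their inverses, correspond to faces. -/
structure IsApproxDirichletDomain (Γ : Subgroup (HypSpace3 ≃ᵢ HypSpace3)) (x : HypSpace3)
    (S : Finset (HypSpace3 ≃ᵢ HypSpace3)) : Prop where
  subset : ∀ g ∈ S, g ∈ Γ
  generators : ∃ T : Set (HypSpace3 ≃ᵢ HypSpace3), Subgroup.closure T = Γ ∧
    ∀ t ∈ T, IsFaceElement S x t ∧ IsFaceElement S x t⁻¹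

/-- An edge of the polyhedron: the intersection of two different faces, if it is more than a
point. -/
def IsEdge (S : Finset (HypSpace3 ≃ᵢ HypSpace3)) (x : HypSpace3) (E : Set HypSpace3) : Prop :=
  ∃ g h, IsFaceElement S x g ∧ IsFaceElement S x h ∧ g x ≠ h x ∧
    E = polyhedron S x ∩ wallPlane x g ∩ wallPlane x h ∧ E.Nontrivial

/-- The spine radius: the maximum over all edges of the minimal distance from the centre to the
edge. -/
def spineRadius (S : Finset (HypSpace3 ≃ᵢ HypSpace3)) (x : HypSpace3) : ℝ :=
  sSup {d : ℝ | ∃ E, IsEdge S x E ∧ d = Metric.infDist x E}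

/-- The covering algorithm in the ball `B(x, R)`. It starts with the polyhedron `D'` itself; when
the translate `h D'` has been found and `s` corresponds to a face of `D'`, the neighbour `(h s) D'`
of `h D'` across that face is added, provided its basepoint lies in the ball. -/
inductive Reached (S : Finset (HypSpace3 ≃ᵢ HypSpace3)) (x : HypSpace3) (R : ℝ) :
    (HypSpace3 ≃ᵢ HypSpace3) → Prop
  | start : Reached S x R 1
  | add_neighbour (h s : HypSpace3 ≃ᵢ HypSpace3) : Reached S x R h → IsFaceElement S x s →
      (h * s) x ∈ Metric.ball x R → Reached S x R (h * s)

end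

end HypSpace3

namespace HypSpace3

open MeasureTheory Filter Topology

theorem cosh_dist (p q : HypSpace3) : Real.cosh (dist p q) = lorentz p q := by
  rw [dist_def, Real.cosh_arcosh (one_le_lorentz p q)]

theorem dist_le_dist_iff {p q p' q' : HypSpace3} :
    dist p q ≤ dist p' q' ↔ lorentz p q ≤ lorentz p' q' := by
  rw [← cosh_dist, ← cosh_dist, Real.cosh_le_cosh, abs_of_nonneg dist_nonneg,
    abs_of_nonneg dist_nonneg]

theorem dist_lt_dist_iff {p q p' q' : HypSpace3} :
    dist p q < dist p' q' ↔ lorentz p q < lorentz p' q' := by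
  rw [← not_le, dist_le_dist_iff, not_le]

theorem dist_eq_of_lorentz_eq_cosh {p q : HypSpace3} {d : ℝ} (hd : 0 ≤ d)
    (h : lorentz p q = Real.cosh d) : dist p q = d := by
  rw [dist_def, h, Real.arcosh_cosh hd]

theorem dist_le_of_lorentz_le_cosh {p q : HypSpace3} {d : ℝ} (hd : 0 ≤ d)
    (h : lorentz p q ≤ Real.cosh d) : dist p q ≤ d := by
  rwa [← cosh_dist, Real.cosh_le_cosh, abs_of_nonneg dist_nonneg, abs_of_nonneg hd] at h

theorem dist_lt_of_lorentz_lt_cosh {p q : HypSpace3} {d : ℝ} (hd : 0 ≤ d)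
    (h : lorentz p q < Real.cosh d) : dist p q < d := by
  rwa [← cosh_dist, Real.cosh_lt_cosh, abs_of_nonneg dist_nonneg, abs_of_nonneg hd] at h

/-- The normalization of a nonnegative combination of two points of the hyperboloid. -/
theorem exists_combination (x y : HypSpace3) {a b : ℝ} (ha : 0 ≤ a) (hb : 0 ≤ b)
    (hab : 0 < a + b) :
    ∃ (p : HypSpace3) (N : ℝ), 0 < N ∧ N ^ 2 = a ^ 2 + b ^ 2 + 2 * a * b * lorentz x y ∧
      ∀ w, N * lorentz w p = a * lorentz w x + b * lorentz w y := by
  have hx := time_sq x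
  have hy := time_sq y
  have hl := one_le_lorentz x y
  have hpos : 0 < a ^ 2 + b ^ 2 + 2 * a * b * lorentz x y := by
    nlinarith [mul_nonneg (mul_nonneg ha hb) (sub_nonneg.2 hl), pow_pos hab 2]
  obtain ⟨N, hN, hN2⟩ : ∃ N : ℝ, 0 < N ∧ N ^ 2 = a ^ 2 + b ^ 2 + 2 * a * b * lorentz x y :=
    ⟨√_, Real.sqrt_pos.2 hpos, Real.sq_sqrt hpos.le⟩
  have hT : 0 ≤ a * x.time + b * y.time :=
    add_nonneg (mul_nonneg ha (time_pos x).le) (mul_nonneg hb (time_pos y).le)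
  have hnorm : ‖a • x.coord + b • y.coord‖ ^ 2 =
      a ^ 2 * ‖x.coord‖ ^ 2 + b ^ 2 * ‖y.coord‖ ^ 2 + 2 * a * b * inner ℝ x.coord y.coord := by
    rw [norm_add_sq_real, norm_smul, norm_smul, mul_pow, mul_pow, inner_smul_left,
      inner_smul_right]
    simp
    ring
  have htime : (HypSpace3.mk (N⁻¹ • (a • x.coord + b • y.coord))).time =
      N⁻¹ * (a * x.time + b * y.time) := by
    rw [time, Real.sqrt_eq_iff_mul_self_eq (by positivity) (by positivity), norm_smul, mul_pow,
      hnorm, norm_inv, Real.norm_of_nonneg hN.le]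
    have : N⁻¹ * N = 1 := inv_mul_cancel₀ hN.ne'
    unfold lorentz at hN2
    linear_combination N⁻¹ ^ 2 * hN2 - (N⁻¹ * N + 1) * this - N⁻¹ ^ 2 * a ^ 2 * hx -
      N⁻¹ ^ 2 * b ^ 2 * hy
  refine ⟨⟨N⁻¹ • (a • x.coord + b • y.coord)⟩, N, hN, hN2, fun w => ?_⟩
  simp only [lorentz, htime, inner_smul_right, inner_add_right]
  field_simp
  ring

/-- A parametrization by arc length of the geodesic from `x` to `y`. -/
theorem exists_geodesic {x y : HypSpace3} (hxy : x ≠ y) :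
    ∃ γ : ℝ → HypSpace3,
      (∀ t, 0 ≤ t → t ≤ dist x y → ∀ w, Real.sinh (dist x y) * lorentz w (γ t) =
        Real.sinh (dist x y - t) * lorentz w x + Real.sinh t * lorentz w y) ∧
      (∀ t, 0 ≤ t → t ≤ dist x y → dist x (γ t) = t ∧ dist y (γ t) = dist x y - t) ∧
      ∀ s t, 0 ≤ s → s ≤ t → t ≤ dist x y → dist (γ s) (γ t) = t - s := by
  set l := dist x y with hl
  have hl0 : 0 < l := dist_pos.2 hxy
  have key : ∀ t, ∃ p : HypSpace3, 0 ≤ t → t ≤ l → ∀ w, Real.sinh l * lorentz w p =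
      Real.sinh (l - t) * lorentz w x + Real.sinh t * lorentz w y := by
    intro t
    by_cases ht : 0 ≤ t ∧ t ≤ l
    · have h1 : 0 ≤ Real.sinh (l - t) := Real.sinh_nonneg_iff.2 (by linarith)
      have h2 : 0 ≤ Real.sinh t := Real.sinh_nonneg_iff.2 ht.1
      have h3 : 0 < Real.sinh (l - t) + Real.sinh t := by
        rcases ht.1.eq_or_lt with h | h
        · rw [← h]; simpa using hl0
        · have := Real.sinh_pos_iff.2 h
          linarith
      obtain ⟨p, N, hN, hN2, hp⟩ := exists_combination x y h1 h2 h3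
      have hNl : N = Real.sinh l := by
        refine (sq_eq_sq₀ hN.le (Real.sinh_nonneg_iff.2 hl0.le)).1 ?_
        rw [hN2, ← cosh_dist, ← hl, Real.sinh_sub]
        linear_combination (-Real.sinh t ^ 2) * Real.cosh_sq l + Real.sinh l ^ 2 * Real.cosh_sq t
      exact ⟨p, fun _ _ w => hNl ▸ hp w⟩
    · exact ⟨x, fun h h' => (ht ⟨h, h'⟩).elim⟩
  choose γ hγ using key
  have hsl : Real.sinh l ≠ 0 := (Real.sinh_pos_iff.2 hl0).ne'
  have hlor : lorentz x y = Real.cosh l := (cosh_dist x y).symm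
  have hends : ∀ t, 0 ≤ t → t ≤ l → lorentz x (γ t) = Real.cosh t ∧
      lorentz y (γ t) = Real.cosh (l - t) := by
    intro t h0 h1
    constructor <;> refine mul_left_cancel₀ hsl ((hγ t h0 h1 _).trans ?_)
    · rw [lorentz_self, hlor, Real.sinh_sub]
      ring
    · rw [lorentz_self, lorentz_comm, hlor, Real.sinh_sub, Real.cosh_sub]
      linear_combination -Real.sinh t * Real.cosh_sq l
  refine ⟨γ, hγ, fun t h0 h1 => ⟨dist_eq_of_lorentz_eq_cosh h0 (hends t h0 h1).1,
    dist_eq_of_lorentz_eq_cosh (sub_nonneg.2 h1) (hends t h0 h1).2⟩, fun s t h0 hst h1 => ?_⟩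
  refine dist_eq_of_lorentz_eq_cosh (sub_nonneg.2 hst)
    (mul_left_cancel₀ hsl ((hγ t (h0.trans hst) h1 _).trans ?_))
  rw [lorentz_comm, (hends s h0 (hst.trans h1)).1, lorentz_comm, (hends s h0 (hst.trans h1)).2,
    Real.sinh_sub, Real.cosh_sub, Real.cosh_sub]
  ring

theorem continuous_mk : Continuous HypSpace3.mk := by
  rw [continuous_iff_continuousAt]
  intro u
  refine tendsto_iff_dist_tendsto_zero.2 ?_
  have h1 : Continuous fun v => lorentz (HypSpace3.mk v) (HypSpace3.mk u) := by
    simp only [lorentz, time]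
    fun_prop
  have h2 : Tendsto (fun v => lorentz (HypSpace3.mk v) (HypSpace3.mk u)) (𝓝 u) (𝓝[Set.Ici 1] 1) :=
    tendsto_nhdsWithin_iff.2 ⟨by simpa [lorentz_self] using h1.tendsto u,
      Eventually.of_forall fun v => one_le_lorentz _ _⟩
  have h3 := (Real.continuousOn_arcosh 1 (by simp)).tendsto.comp h2
  simpa [Function.comp_def, dist_def] using h3

theorem norm_coord_le (o p : HypSpace3) (ho : o.coord = 0) : ‖p.coord‖ ≤ Real.cosh (dist o p) := by
  have h : o.time = 1 := by simp [time, ho]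
  rw [cosh_dist, lorentz, h, ho, inner_zero_left, one_mul, sub_zero]
  exact Real.le_sqrt_of_sq_le (by linarith)

/-- Bounded sets of the hyperbolic space lie in compact sets. -/
theorem exists_compact_superset (z : HypSpace3) (C : ℝ) :
    ∃ K : Set HypSpace3, IsCompact K ∧ ∀ p, dist p z ≤ C → p ∈ K := by
  refine ⟨HypSpace3.mk '' Metric.closedBall 0 (Real.cosh (dist ⟨0⟩ z + C)),
    (isCompact_closedBall _ _).image continuous_mk, fun p hp => ⟨p.coord, ?_, rfl⟩⟩
  rw [mem_closedBall_zero_iff]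
  refine (norm_coord_le ⟨0⟩ p rfl).trans (Real.cosh_le_cosh.2 ?_)
  have := dist_triangle_right (⟨0⟩ : HypSpace3) p z
  rw [abs_of_nonneg dist_nonneg]
  exact le_trans (by linarith) (le_abs_self _)

theorem IsManifoldGroup.finite_orbit_near {Γ : Subgroup (HypSpace3 ≃ᵢ HypSpace3)}
    (hΓ : IsManifoldGroup Γ) (x z : HypSpace3) (C : ℝ) : {k | k ∈ Γ ∧ dist (k x) z ≤ C}.Finite := by
  obtain ⟨K, hK, hmem⟩ := exists_compact_superset z (max C (dist x z))
  refine (hΓ.properlyDiscontinuous K hK).subset fun k hk => ⟨hk.1, k x, ?_, ?_⟩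
  · exact ⟨x, hmem x (le_max_right _ _), rfl⟩
  · exact hmem _ (hk.2.trans (le_max_left _ _))

/-- A point outside the polyhedron is separated from it by the wall of a face element. -/
theorem exists_isFaceElement_dist_lt {S : Finset (HypSpace3 ≃ᵢ HypSpace3)} {x z : HypSpace3}
    (hz : z ∉ polyhedron S x) : ∃ s, IsFaceElement S x s ∧ dist (s x) z < dist x z := by
  classical
  obtain ⟨A, hAS, hA⟩ := exists_minimal_le_of_wellFoundedLT
    (fun A : Finset (HypSpace3 ≃ᵢ HypSpace3) => polyhedron A x = polyhedron S x) S rfl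
  have hAeq : polyhedron A x = polyhedron S x := hA.prop
  rw [← hAeq] at hz
  obtain ⟨s, hsA, hs⟩ : ∃ s ∈ A, dist (s x) z < dist x z := by
    simpa [polyhedron] using hz
  refine ⟨s, ?_, hs⟩
  obtain ⟨w, hw, hsw⟩ : ∃ w ∈ polyhedron (A.erase s) x, dist (s x) w < dist x w := by
    by_contra! hcon
    have : polyhedron (A.erase s) x = polyhedron S x := by
      rw [← hAeq]
      ext w
      refine ⟨fun hw g hg => ?_, fun hw g hg => hw g (Finset.mem_of_mem_erase hg)⟩
      by_cases hgs : g = s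
      · exact hgs ▸ hcon w hw
      · exact hw g (Finset.mem_erase.2 ⟨hgs, hg⟩)
    exact Finset.notMem_erase s A (hA.le_of_le this (Finset.erase_subset s A) hsA)
  have hsx : s x ≠ x := fun h => by rw [h] at hsw; exact lt_irrefl _ hsw
  have pos : ∀ g : HypSpace3 ≃ᵢ HypSpace3, g x ≠ x → lorentz x x < lorentz (g x) x := fun g hg => by
    rw [← dist_lt_dist_iff, dist_self]
    exact dist_pos.2 hg
  have h1 : 0 < lorentz (s x) x - lorentz x x := sub_pos.2 (pos s hsx)
  have h2 : 0 < lorentz x w - lorentz (s x) w := sub_pos.2 (dist_lt_dist_iff.1 hsw)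
  obtain ⟨p, N, hN, -, hp⟩ := exists_combination x w h2.le h1.le (add_pos h2 h1)
  have hpw : p ∈ wallPlane x s := by
    have : N * lorentz x p = N * lorentz (s x) p := by
      rw [hp, hp]
      ring
    have := mul_left_cancel₀ hN.ne' this
    exact le_antisymm (dist_le_dist_iff.2 this.le) (dist_le_dist_iff.2 this.ge)
  refine ⟨hAS hsA, fun h => hsx (by rw [h]; rfl), p, hpw, ?_⟩
  have hev : ∀ᶠ v in 𝓝 p, ∀ g ∈ A.erase s, dist x v ≤ dist (g x) v := by
    rw [eventually_all_finset]
    intro g hg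
    by_cases hgx : g x = x
    · simp [hgx]
    have hlt : dist x p < dist (g x) p := by
      rw [dist_lt_dist_iff]
      refine lt_of_mul_lt_mul_left ?_ hN.le
      rw [hp, hp]
      have h3 := mul_lt_mul_of_pos_left (pos g hgx) h2
      have h4 := mul_le_mul_of_nonneg_left (dist_le_dist_iff.1 (hw g hg)) h1.le
      linarith
    have hc : Continuous fun v => dist (g x) v - dist x v := by fun_prop
    filter_upwards [hc.tendsto p |>.eventually (lt_mem_nhds (sub_pos.2 hlt))] with v hv
    linarith
  obtain ⟨δ, hδ, hball⟩ := Metric.eventually_nhds_iff_ball.1 hev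
  refine ⟨δ, hδ, fun v hv => ?_⟩
  rw [← hAeq]
  intro g hg
  by_cases hgs : g = s
  · rw [hgs]
    exact le_of_eq hv.2
  · exact hball v hv.1 g (Finset.mem_erase.2 ⟨hgs, hg⟩)

theorem exp_neg_mul_cosh_le {a b r : ℝ} (ha : 0 ≤ a) (hr : 0 ≤ r) (h : a ≤ b + r) :
    Real.exp (-r) * Real.cosh a ≤ Real.cosh b := by
  rw [Real.exp_neg, inv_mul_le_iff₀ (Real.exp_pos r), ← Real.cosh_add_sinh]
  calc Real.cosh a ≤ Real.cosh (b + r) := by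
        rw [Real.cosh_le_cosh, abs_of_nonneg ha]
        exact h.trans (le_abs_self _)
    _ = Real.cosh r * Real.cosh b + Real.sinh b * Real.sinh r := by rw [Real.cosh_add]; ring
    _ ≤ Real.cosh r * Real.cosh b + Real.cosh b * Real.sinh r := by
        have := Real.sinh_nonneg_iff.2 hr
        have := (Real.sinh_lt_cosh b).le
        gcongr
    _ = (Real.cosh r + Real.sinh r) * Real.cosh b := by ring

/-- Halfspaces that contain a point `z` and are at distance at least `ρ` from `x` all contain a
common ball close to `z`. -/
theorem exists_ball_subset_halfspaces {ρ C η : ℝ} (hρ : 0 < ρ) (hη : 0 < η) :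
    ∃ r, 0 < r ∧ ∀ x z : HypSpace3, dist x z ≤ C → ∃ q, Metric.ball q r ⊆ Metric.ball z η ∧
      ∀ w, 2 * ρ ≤ dist x w → dist x z ≤ dist w z →
        ∀ v ∈ Metric.ball q r, dist x v ≤ dist w v := by
  have hC := Real.cosh_pos C
  have hη1 : 1 < Real.cosh (η / 2) := Real.one_lt_cosh.2 (by positivity)
  have hρ1 : 1 < Real.cosh (2 * ρ) := Real.one_lt_cosh.2 (by positivity)
  obtain ⟨s, hs, hsC⟩ : ∃ s, 0 < s ∧ 1 + s * Real.cosh C ≤ Real.cosh (η / 2) :=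
    ⟨(Real.cosh (η / 2) - 1) / Real.cosh C, div_pos (by linarith) hC, by
      rw [div_mul_cancel₀ _ hC.ne']; linarith⟩
  set m := 1 + s * (Real.cosh (2 * ρ) - 1) / (Real.cosh C + s) with hm
  have hm1 : 1 < m := by
    have : 0 < s * (Real.cosh (2 * ρ) - 1) / (Real.cosh C + s) :=
      div_pos (mul_pos hs (by linarith)) (by linarith)
    linarith
  have hlog : 0 < Real.log m := Real.log_pos hm1
  refine ⟨min (Real.log m / 2) (η / 2), by positivity, fun x z hxz => ?_⟩
  set r := min (Real.log m / 2) (η / 2) with hr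
  have hr0 : 0 < r := by positivity
  have hrm : Real.exp r * Real.exp r ≤ m := by
    rw [← Real.exp_add, ← Real.le_log_iff_exp_le (by linarith)]
    have := min_le_left (Real.log m / 2) (η / 2)
    linarith
  obtain ⟨q, N, hN, hN2, hq⟩ := exists_combination z x zero_le_one hs.le (by linarith)
  have hl := one_le_lorentz z x
  have hlC : lorentz z x ≤ Real.cosh C := by
    rw [← cosh_dist, dist_comm, Real.cosh_le_cosh, abs_of_nonneg dist_nonneg]
    exact hxz.trans (le_abs_self C)
  have hN1 : 1 ≤ N := by
    nlinarith [mul_pos hs (by linarith : 0 < lorentz z x)]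
  have hzq : dist z q ≤ η / 2 := by
    refine dist_le_of_lorentz_le_cosh (by positivity) ?_
    have := hq z
    rw [lorentz_self] at this
    have h1 := one_le_lorentz z q
    nlinarith
  refine ⟨q, Metric.ball_subset_ball' ?_, fun w hw hwz v hv => ?_⟩
  · have := min_le_right (Real.log m / 2) (η / 2)
    rw [dist_comm] at hzq
    linarith
  rw [dist_le_dist_iff]
  rw [Metric.mem_ball] at hv
  have hxq : m * lorentz x q ≤ lorentz w q := by
    refine le_of_mul_le_mul_left ?_ hN
    have hwx : Real.cosh (2 * ρ) ≤ lorentz w x := by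
      rw [← cosh_dist, Real.cosh_le_cosh, abs_of_nonneg dist_nonneg, abs_of_pos (by positivity),
        dist_comm]
      exact hw
    have hwz' := dist_le_dist_iff.1 hwz
    calc N * (m * lorentz x q) = m * (N * lorentz x q) := by ring
      _ = m * (lorentz z x + s) := by rw [hq, lorentz_self, lorentz_comm]; ring
      _ = lorentz z x + s +
          s * (Real.cosh (2 * ρ) - 1) * ((lorentz z x + s) / (Real.cosh C + s)) := by
        rw [hm]; ring
      _ ≤ lorentz z x + s + s * (Real.cosh (2 * ρ) - 1) * 1 := by
        have : (lorentz z x + s) / (Real.cosh C + s) ≤ 1 := (div_le_one (by linarith)).2 (by linarith)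
        have h0 : 0 ≤ s * (Real.cosh (2 * ρ) - 1) := mul_nonneg hs.le (by linarith)
        gcongr
      _ = lorentz x z + s * Real.cosh (2 * ρ) := by rw [lorentz_comm]; ring
      _ ≤ 1 * lorentz w z + s * lorentz w x := by
        rw [one_mul]
        gcongr
      _ = N * lorentz w q := (hq w).symm
  have h1 : Real.exp (-r) * lorentz x v ≤ lorentz x q := by
    rw [← cosh_dist, ← cosh_dist]
    refine exp_neg_mul_cosh_le dist_nonneg hr0.le ?_
    linarith [dist_triangle x q v, dist_comm q v]
  have h2 : Real.exp (-r) * lorentz w q ≤ lorentz w v := by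
    rw [← cosh_dist, ← cosh_dist]
    refine exp_neg_mul_cosh_le dist_nonneg hr0.le ?_
    linarith [dist_triangle w v q]
  have he : Real.exp (-r) * Real.exp r = 1 := by rw [← Real.exp_add]; simp
  have hxq1 := one_le_lorentz x q
  calc lorentz x v = Real.exp r * (Real.exp (-r) * lorentz x v) := by
        rw [← mul_assoc, mul_comm (Real.exp r), he, one_mul]
    _ ≤ Real.exp r * lorentz x q := by gcongr
    _ = Real.exp (-r) * (Real.exp r * Real.exp r * lorentz x q) := by
        linear_combination (-Real.exp r * lorentz x q) * he
    _ ≤ Real.exp (-r) * (m * lorentz x q) := by gcongr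
    _ ≤ Real.exp (-r) * lorentz w q := by gcongr
    _ ≤ lorentz w v := h2

/-- The affine map `v ↦ q + v + ⟨q, v⟩ / (t + 1) q` osculates the boost that moves the origin
to `q`. -/
theorem time_sq_boost (q : HypSpace3) (v : EuclideanSpace ℝ (Fin 3)) :
    1 + ‖q.coord + (v + (inner ℝ q.coord v / (q.time + 1)) • q.coord)‖ ^ 2 =
      (q.time + inner ℝ q.coord v) ^ 2 + ‖v‖ ^ 2 := by
  have ht := time_sq q
  have hpos := time_pos q
  have hne : q.time + 1 ≠ 0 := by linarith
  set c := inner ℝ q.coord v / (q.time + 1) with hc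
  have hc' : inner ℝ q.coord v = c * (q.time + 1) := by rw [hc]; field_simp
  have hv : inner ℝ v q.coord = c * (q.time + 1) := by rw [real_inner_comm, hc']
  rw [norm_add_sq_real, norm_add_sq_real, inner_add_right, inner_smul_right, inner_smul_right,
    norm_smul, mul_pow, Real.norm_eq_abs, sq_abs, real_inner_self_eq_norm_sq, hv, hc']
  linear_combination (-1 - 2 * c - c ^ 2) * ht

theorem hvol_ball_lower_bound {r : ℝ} (hr : 0 < r) :
    ∃ c, 0 < c ∧ ∀ q : HypSpace3, ENNReal.ofReal c ≤ hvol (Metric.ball q r) := by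
  have hr1 : 1 < Real.cosh r := Real.one_lt_cosh.2 hr.ne'
  obtain ⟨δ, hδ, hδ2, hδr⟩ : ∃ δ : ℝ, 0 < δ ∧ δ ≤ 1 / 2 ∧ 1 + δ ^ 2 ≤ Real.cosh r := by
    refine ⟨min (1 / 2) (Real.cosh r - 1), lt_min (by norm_num) (by linarith), min_le_left _ _, ?_⟩
    have h1 := min_le_left (1 / 2) (Real.cosh r - 1)
    have h2 := min_le_right (1 / 2) (Real.cosh r - 1)
    have h3 : 0 < min (1 / 2) (Real.cosh r - 1) := lt_min (by norm_num) (by linarith)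
    nlinarith
  set B := Metric.ball (0 : EuclideanSpace ℝ (Fin 3)) δ with hB
  have hBtop : volume B ≠ ⊤ := measure_ball_lt_top.ne
  have hBpos : 0 < (volume B).toReal :=
    ENNReal.toReal_pos (Metric.measure_ball_pos volume _ hδ).ne' hBtop
  refine ⟨(volume B).toReal / 2, by positivity, fun q => ?_⟩
  have ht := time_sq q
  have hpos := time_pos q
  set f : EuclideanSpace ℝ (Fin 3) →ₗ[ℝ] EuclideanSpace ℝ (Fin 3) :=
    LinearMap.transvection ((q.time + 1)⁻¹ • (innerₗ _ q.coord)) q.coord with hf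
  have hfv : ∀ v, f v = v + (inner ℝ q.coord v / (q.time + 1)) • q.coord := fun v => by
    simp [hf, LinearMap.transvection.apply, div_eq_inv_mul]
  have hdet : LinearMap.det f = q.time := by
    rw [hf, LinearMap.transvection.det]
    simp
    field_simp
    linear_combination -ht
  have hbound : ∀ v ∈ B, (HypSpace3.mk (q.coord + f v)).time ≤ 2 * q.time ∧
      HypSpace3.mk (q.coord + f v) ∈ Metric.ball q r := by
    intro v hv
    have hvδ : ‖v‖ < δ := mem_ball_zero_iff.1 hv
    have hqt : ‖q.coord‖ ≤ q.time := Real.le_sqrt_of_sq_le (by linarith)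
    have hin : |inner ℝ q.coord v| ≤ q.time * ‖v‖ :=
      (abs_real_inner_le_norm _ _).trans (by gcongr)
    have hn := norm_nonneg v
    obtain ⟨hin1, hin2⟩ := abs_le.1 hin
    have hhalf : q.time * ‖v‖ ≤ q.time / 2 := by nlinarith
    have h1 : 1 ≤ q.time := by nlinarith [sq_nonneg ‖q.coord‖]
    have htime : (HypSpace3.mk (q.coord + f v)).time ≤
        q.time + inner ℝ q.coord v + ‖v‖ ^ 2 / q.time := by
      have hd : 0 ≤ ‖v‖ ^ 2 / q.time := by positivity
      have hdt : ‖v‖ ^ 2 = ‖v‖ ^ 2 / q.time * q.time := by field_simp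
      refine Real.sqrt_le_iff.2 ⟨by linarith, ?_⟩
      rw [hfv, time_sq_boost]
      nlinarith [mul_nonneg hd (by linarith : 0 ≤ q.time + 2 * inner ℝ q.coord v)]
    constructor
    · refine htime.trans ?_
      have : ‖v‖ ^ 2 / q.time ≤ 1 / 4 := by
        rw [div_le_iff₀ hpos]
        nlinarith
      linarith
    · rw [Metric.mem_ball, dist_comm]
      refine dist_lt_of_lorentz_lt_cosh hr.le (lt_of_lt_of_le ?_ hδr)
      have hinner : inner ℝ q.coord (q.coord + f v) =
          ‖q.coord‖ ^ 2 + q.time * inner ℝ q.coord v := by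
        rw [hfv, inner_add_right, inner_add_right, inner_smul_right, real_inner_self_eq_norm_sq]
        field_simp
        linear_combination (-inner ℝ q.coord v) * ht
      have hmul := mul_le_mul_of_nonneg_left htime hpos.le
      rw [mul_add, mul_div_cancel₀ _ hpos.ne'] at hmul
      simp only [lorentz]
      rw [hinner]
      nlinarith
  set A := (fun u => q.coord + u) '' (f '' B) with hA
  have hvolA : volume A = ENNReal.ofReal q.time * volume B := by
    rw [hA, Set.image_add_left, measure_preimage_add, Measure.addHaar_image_linearMap, hdet,
      abs_of_pos hpos]
  calc ENNReal.ofReal ((volume B).toReal / 2)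
      = ENNReal.ofReal (1 / (2 * q.time)) * volume A := by
        rw [hvolA, ← ENNReal.ofReal_toReal hBtop, ← ENNReal.ofReal_mul hpos.le,
          ← ENNReal.ofReal_mul (by positivity), ENNReal.toReal_ofReal ENNReal.toReal_nonneg]
        congr 1
        field_simp
    _ = ∫⁻ _ in A, ENNReal.ofReal (1 / (2 * q.time)) := by rw [setLIntegral_const]
    _ ≤ ∫⁻ u in A, ENNReal.ofReal (1 / √(1 + ‖u‖ ^ 2)) := by
        refine setLIntegral_mono (by fun_prop) ?_
        rintro _ ⟨_, ⟨v, hv, rfl⟩, rfl⟩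
        exact ENNReal.ofReal_le_ofReal
          (one_div_le_one_div_of_le (time_pos (HypSpace3.mk _)) (hbound v hv).1)
    _ ≤ hvol (Metric.ball q r) := by
        refine lintegral_mono_set ?_
        rintro _ ⟨_, ⟨v, hv, rfl⟩, rfl⟩
        exact (hbound v hv).2

theorem hvol_add_le {A B C : Set HypSpace3} (hB : IsOpen B) (hAC : A ⊆ C) (hBC : B ⊆ C)
    (hAB : Disjoint A B) : hvol A + hvol B ≤ hvol C := by
  refine (lintegral_union (hB.preimage continuous_mk).measurableSet
    (hAB.preimage HypSpace3.mk)).symm.le.trans ?_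
  exact lintegral_mono_set fun u hu => hu.elim (fun h => hAC h) fun h => hBC h

theorem two_mul_le_dist_of_le_injRadius {Γ : Subgroup (HypSpace3 ≃ᵢ HypSpace3)} {x : HypSpace3}
    {ρ : ℝ} (h : ρ ≤ injRadius Γ x) {g : HypSpace3 ≃ᵢ HypSpace3} (hg : g ∈ Γ) (hg1 : g ≠ 1) :
    2 * ρ ≤ dist x (g x) := by
  have : sInf {d : ℝ | ∃ g ∈ Γ, g ≠ 1 ∧ d = dist x (g x)} ≤ dist x (g x) :=
    csInf_le ⟨0, by rintro _ ⟨_, -, -, rfl⟩; exact dist_nonneg⟩ ⟨g, hg, hg1, rfl⟩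
  unfold injRadius at h
  linarith

theorem two_mul_le_dist_orbit {Γ : Subgroup (HypSpace3 ≃ᵢ HypSpace3)} {x : HypSpace3}
    {ρ : ℝ} (h : ρ ≤ injRadius Γ x) {g k : HypSpace3 ≃ᵢ HypSpace3} (hg : g ∈ Γ) (hk : k ∈ Γ)
    (hgk : k ≠ g) : 2 * ρ ≤ dist (k x) (g x) := by
  have h1 := two_mul_le_dist_of_le_injRadius h (mul_mem (inv_mem hk) hg)
    fun h => hgk (inv_mul_eq_one.1 h)
  rwa [← k.dist_eq, IsometryEquiv.mul_apply, IsometryEquiv.apply_inv_self] at h1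

/-- A polyhedron whose volume exceeds that of the Dirichlet domain by little is, within bounded
distance of its centre, almost contained in it. -/
theorem exists_volume_gap {ρ C η : ℝ} (hρ : 0 < ρ) (hη : 0 < η) :
    ∃ ε, 0 < ε ∧ ∀ (Γ : Subgroup (HypSpace3 ≃ᵢ HypSpace3)) (x : HypSpace3)
      (S : Finset (HypSpace3 ≃ᵢ HypSpace3)), ρ ≤ injRadius Γ x → (∀ g ∈ S, g ∈ Γ) →
      hvol (polyhedron S x) < hvol (dirichletDomain Γ x) + ENNReal.ofReal ε →
      ∀ z ∈ polyhedron S x, dist x z ≤ C → ∀ g ∈ Γ, dist x z ≤ dist (g x) z + η := by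
  obtain ⟨r, hr, hball⟩ := exists_ball_subset_halfspaces (C := C) hρ (half_pos hη)
  obtain ⟨ε, hε, hvol⟩ := hvol_ball_lower_bound hr
  refine ⟨ε, hε, fun Γ x S hinj hS hlt z hz hxz g hg => ?_⟩
  by_contra! hcon
  obtain ⟨q, hqz, hq⟩ := hball x z hxz
  refine hlt.not_ge (le_trans (add_le_add_right (hvol q) _)
    (hvol_add_le Metric.isOpen_ball ?_ ?_ ?_))
  · intro v hv s hs
    by_cases h1 : s = 1
    · rw [h1]; exact le_rfl
    · exact hv s (hS s hs) h1
  · intro v hv s hs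
    by_cases h1 : s = 1
    · rw [h1]; exact le_rfl
    · exact hq (s x) (two_mul_le_dist_of_le_injRadius hinj (hS s hs) h1) (hz s hs) v hv
  · rw [Set.disjoint_left]
    intro v hv hvq
    have hvz := Metric.mem_ball.1 (hqz hvq)
    have hg1 : g ≠ 1 := by
      rintro rfl
      rw [IsometryEquiv.coe_one, id] at hcon
      linarith
    have h1 := hv g hg hg1
    have h3 := dist_triangle x v z
    have h4 := dist_triangle (g x) z v
    rw [dist_comm z v] at h4
    linarith

/-- A point `w` away from `x` and `y` that is nearly as close to a point `z` of the geodesic from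
`x` to `y` as these are to `z` is no further from `x` than `y`. -/
theorem exists_gap_on_geodesic {R ρ : ℝ} (hR : 0 < R) (hρ : 0 < ρ) :
    ∃ κ, 0 < κ ∧ κ < ρ ∧ ∀ (x y w z : HypSpace3) (a b : ℝ), dist x z = b → dist y z = a →
      a + b ≤ R →
      Real.sinh (a + b) * lorentz w z = Real.sinh a * lorentz w x + Real.sinh b * lorentz w y →
      2 * ρ ≤ dist w x → 2 * ρ ≤ dist w y → dist w z ≤ b + κ → dist w z ≤ a + κ →
      dist w x ≤ a + b := by
  have hρ1 : 1 < Real.cosh (2 * ρ) := Real.one_lt_cosh.2 (by positivity)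
  have hs : 0 < Real.sinh (ρ / 2) := Real.sinh_pos_iff.2 (by positivity)
  obtain ⟨κ, hκ, hκρ, hκR⟩ : ∃ κ, 0 < κ ∧ κ < ρ ∧
      Real.sinh R * (Real.cosh R * (Real.cosh κ - 1) + Real.sinh R * Real.sinh κ) ≤
        Real.sinh (ρ / 2) * (Real.cosh (2 * ρ) - 1) := by
    have hc : Continuous fun κ : ℝ =>
      Real.sinh R * (Real.cosh R * (Real.cosh κ - 1) + Real.sinh R * Real.sinh κ) := by fun_prop
    have h1 := (hc.tendsto 0).eventually_lt_const (u := Real.sinh (ρ / 2) *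
      (Real.cosh (2 * ρ) - 1)) (by simpa using mul_pos hs (sub_pos.2 hρ1))
    obtain ⟨κ, h4, h2, h3⟩ :=
      ((h1.filter_mono nhdsWithin_le_nhds).and (Ioo_mem_nhdsGT hρ)).exists
    exact ⟨κ, h2, h3, h4.le⟩
  refine ⟨κ, hκ, hκρ, fun x y w z a b hb ha hab hst hwx hwy hzb hza => ?_⟩
  have ha0 : 0 ≤ a := ha ▸ dist_nonneg
  have hb0 : 0 ≤ b := hb ▸ dist_nonneg
  have hb2 : ρ / 2 ≤ b := by linarith [dist_triangle_right w x z]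
  have hapos : 0 < a := by linarith [dist_triangle_right w y z]
  refine dist_le_of_lorentz_le_cosh (by linarith) (le_of_mul_le_mul_left ?_
    (Real.sinh_pos_iff.2 hapos))
  have hwz : lorentz w z ≤ Real.cosh (a + κ) := by
    rw [← cosh_dist, Real.cosh_le_cosh, abs_of_nonneg dist_nonneg, abs_of_nonneg (by linarith)]
    exact hza
  have hwy' : Real.cosh (2 * ρ) ≤ lorentz w y := by
    rw [← cosh_dist, Real.cosh_le_cosh, abs_of_nonneg dist_nonneg, abs_of_nonneg (by linarith)]
    exact hwy
  have hsb : Real.sinh (ρ / 2) ≤ Real.sinh b := Real.sinh_le_sinh.2 hb2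
  have hsR : Real.sinh (a + b) ≤ Real.sinh R := Real.sinh_le_sinh.2 hab
  have hs0 : 0 ≤ Real.sinh (a + b) := Real.sinh_nonneg_iff.2 (by linarith)
  have hκs : 0 ≤ Real.sinh κ := Real.sinh_nonneg_iff.2 hκ.le
  have hκc := Real.one_le_cosh κ
  have hca : Real.cosh a ≤ Real.cosh R := by
    rw [Real.cosh_le_cosh, abs_of_nonneg ha0, abs_of_pos hR]
    linarith
  have hsa : Real.sinh a ≤ Real.sinh R := Real.sinh_le_sinh.2 (by linarith)
  have hdiff : Real.cosh (a + κ) - Real.cosh a ≤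
      Real.cosh R * (Real.cosh κ - 1) + Real.sinh R * Real.sinh κ := by
    rw [Real.cosh_add]
    nlinarith [mul_le_mul_of_nonneg_right hca (sub_nonneg.2 hκc),
      mul_le_mul_of_nonneg_right hsa hκs]
  have hdiff0 : 0 ≤ Real.cosh (a + κ) - Real.cosh a := by
    rw [sub_nonneg, Real.cosh_le_cosh, abs_of_nonneg ha0, abs_of_nonneg (by linarith)]
    linarith
  have hid : Real.sinh (a + b) * Real.cosh a - Real.sinh b = Real.sinh a * Real.cosh (a + b) := by
    rw [Real.sinh_add, Real.cosh_add]
    linear_combination Real.sinh b * Real.cosh_sq a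
  have h1 : Real.sinh (a + b) * (Real.cosh (a + κ) - Real.cosh a) ≤
      Real.sinh b * (lorentz w y - 1) :=
    calc _ ≤ Real.sinh R *
          (Real.cosh R * (Real.cosh κ - 1) + Real.sinh R * Real.sinh κ) := by gcongr
      _ ≤ _ := hκR
      _ ≤ _ := by
        have : 0 ≤ Real.cosh (2 * ρ) - 1 := by linarith
        have : 0 ≤ Real.sinh b := Real.sinh_nonneg_iff.2 hb0
        gcongr
  have h2 := mul_le_mul_of_nonneg_left hwz hs0
  linarith

theorem Reached.mem {Γ : Subgroup (HypSpace3 ≃ᵢ HypSpace3)} {S : Finset (HypSpace3 ≃ᵢ HypSpace3)}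
    (hS : ∀ g ∈ S, g ∈ Γ) {x : HypSpace3} {R : ℝ} {k : HypSpace3 ≃ᵢ HypSpace3}
    (h : Reached S x R k) : k ∈ Γ := by
  induction h with
  | start => exact one_mem Γ
  | add_neighbour h s _ hs _ ih => exact mul_mem ih (hS s hs.1)

/-- Near a point `z` at which every translate that is nearly closest has its basepoint in the ball,
the covering algorithm descends to a translate of the polyhedron that contains `z`. -/
theorem Reached.exists_mem_polyhedron {Γ : Subgroup (HypSpace3 ≃ᵢ HypSpace3)}
    (hΓ : IsManifoldGroup Γ) {S : Finset (HypSpace3 ≃ᵢ HypSpace3)} (hS : ∀ g ∈ S, g ∈ Γ)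
    {x z : HypSpace3} {R : ℝ} {k : HypSpace3 ≃ᵢ HypSpace3} (hk : Reached S x R k)
    (hball : ∀ h ∈ Γ, dist (h x) z ≤ dist (k x) z → h x ∈ Metric.ball x R) :
    ∃ h, Reached S x R h ∧ dist (h x) z ≤ dist (k x) z ∧ h⁻¹ z ∈ polyhedron S x := by
  have hfin : {h | Reached S x R h ∧ dist (h x) z ≤ dist (k x) z}.Finite :=
    (hΓ.finite_orbit_near x z (dist (k x) z)).subset fun h hh => ⟨hh.1.mem hS, hh.2⟩
  obtain ⟨h, ⟨hh, hhk⟩, hmin⟩ :=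
    Set.exists_min_image _ (fun h : HypSpace3 ≃ᵢ HypSpace3 => dist (h x) z) hfin ⟨k, hk, le_rfl⟩
  refine ⟨h, hh, hhk, ?_⟩
  by_contra hcon
  obtain ⟨s, hs, hlt⟩ := exists_isFaceElement_dist_lt hcon
  rw [← h.dist_eq, ← h.dist_eq x, IsometryEquiv.apply_inv_self, ← IsometryEquiv.mul_apply] at hlt
  have hle := hlt.le.trans hhk
  exact hlt.not_ge (hmin (h * s) ⟨hh.add_neighbour h s hs
    (hball _ (mul_mem (hh.mem hS) (hS s hs.1)) hle), hle⟩)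

end HypSpace3

open HypSpace3

theorem theorem1 (R ρ : ℝ) (hR : 0 < R) (hρ : 0 < ρ) :
    ∃ ε : ℝ, 0 < ε ∧
      ∀ (Γ : Subgroup (HypSpace3 ≃ᵢ HypSpace3)) (x : HypSpace3)
        (S : Finset (HypSpace3 ≃ᵢ HypSpace3)),
        HypSpace3.IsManifoldGroup Γ →
        HypSpace3.hvol (HypSpace3.dirichletDomain Γ x) < ⊤ →
        ρ ≤ HypSpace3.injRadius Γ x →
        HypSpace3.IsApproxDirichletDomain Γ x S →
        HypSpace3.hvol (HypSpace3.polyhedron S x) <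
          HypSpace3.hvol (HypSpace3.dirichletDomain Γ x) + ENNReal.ofReal ε →
        IsLocalMin (fun y => HypSpace3.spineRadius S y) x →
        ∀ g ∈ Γ, g x ∈ Metric.ball x R → HypSpace3.Reached S x R g := by
  obtain ⟨κ, hκ, hκρ, hgap⟩ := exists_gap_on_geodesic hR hρ
  obtain ⟨ε, hε, hclose⟩ := exists_volume_gap (C := R + κ) hρ (half_pos hκ)
  refine ⟨ε, hε, fun Γ x S hΓ _ hinj hS hvol _ g hg hgR => ?_⟩
  by_cases hg1 : g = 1
  · exact hg1 ▸ Reached.start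
  have hlt : dist x (g x) < R := by rwa [dist_comm]
  have hxg : x ≠ g x := fun h => hg1 (hΓ.free g hg x h.symm)
  obtain ⟨γ, hγ, hends, hstep⟩ := exists_geodesic hxg
  set l := dist x (g x) with hl
  have hl0 : 0 ≤ l := dist_nonneg
  have advance : ∀ s t k, 0 ≤ s → s ≤ t → t ≤ l → t - s ≤ κ / 4 → Reached S x R k →
      (∀ h ∈ Γ, dist (k x) (γ s) ≤ dist (h x) (γ s) + κ / 2) →
      ∃ k', Reached S x R k' ∧ ∀ h ∈ Γ, dist (k' x) (γ t) ≤ dist (h x) (γ t) + κ / 2 := by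
    intro s t k hs hst htl hts hk hks
    have ht0 := hs.trans hst
    obtain ⟨hxt, hgt⟩ := hends t ht0 htl
    have hd := hstep s t hs hst htl
    have hkt : ∀ h ∈ Γ, dist (k x) (γ t) ≤ dist (h x) (γ t) + κ := fun h hh => by
      linarith [hks h hh, dist_triangle (k x) (γ s) (γ t), dist_triangle_right (h x) (γ s) (γ t)]
    have hk1 : dist (k x) (γ t) ≤ t + κ :=
      (hkt 1 (one_mem Γ)).trans_eq (congrArg (· + κ) hxt)
    have hkg : dist (k x) (γ t) ≤ l - t + κ :=
      (hkt g hg).trans_eq (congrArg (· + κ) hgt)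
    have hball : ∀ h ∈ Γ, dist (h x) (γ t) ≤ dist (k x) (γ t) → h x ∈ Metric.ball x R := by
      intro h hh hhk
      by_cases h1 : h = 1
      · rw [h1]
        exact Metric.mem_ball_self hR
      by_cases h2 : h = g
      · rwa [h2]
      have hst : Real.sinh (l - t + t) * lorentz (h x) (γ t) =
          Real.sinh (l - t) * lorentz (h x) x + Real.sinh t * lorentz (h x) (g x) := by
        rw [sub_add_cancel]
        exact hγ t ht0 htl _
      have hhx : 2 * ρ ≤ dist (h x) x := by
        rw [dist_comm]
        exact two_mul_le_dist_of_le_injRadius hinj hh h1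
      have := hgap x (g x) (h x) (γ t) (l - t) t hxt hgt (by linarith) hst hhx
        (two_mul_le_dist_orbit hinj hg hh h2) (hhk.trans hk1) (hhk.trans hkg)
      rw [Metric.mem_ball]
      linarith
    obtain ⟨k', hk', hle, hmem⟩ := hk.exists_mem_polyhedron hΓ hS.subset hball
    refine ⟨k', hk', fun h hh => ?_⟩
    have hdist : ∀ p, dist p (k'⁻¹ (γ t)) = dist (k' p) (γ t) := fun p => by
      rw [← k'.dist_eq, IsometryEquiv.apply_inv_self]
    have := hclose Γ x S hinj hS.subset hvol _ hmem (by rw [hdist]; linarith) (k'⁻¹ * h)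
      (mul_mem (inv_mem (hk'.mem hS.subset)) hh)
    rwa [hdist, hdist, IsometryEquiv.mul_apply, IsometryEquiv.apply_inv_self] at this
  obtain ⟨n, hn⟩ := exists_nat_gt (l / (κ / 4))
  have hn0 : (0 : ℝ) < n := lt_of_le_of_lt (by positivity) hn
  have hln : l / n ≤ κ / 4 := by
    rw [div_lt_iff₀ (by positivity)] at hn
    rw [div_le_iff₀ hn0]
    linarith
  have walk : ∀ i : ℕ, i ≤ n → ∃ k, Reached S x R k ∧
      ∀ h ∈ Γ, dist (k x) (γ (i * (l / n))) ≤ dist (h x) (γ (i * (l / n))) + κ / 2 := by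
    intro i
    induction i with
    | zero =>
      refine fun _ => ⟨1, Reached.start, fun h _ => ?_⟩
      have h0 : dist ((1 : HypSpace3 ≃ᵢ HypSpace3) x) (γ 0) = 0 := (hends 0 le_rfl hl0).1
      rw [Nat.cast_zero, zero_mul, h0]
      positivity
    | succ i ih =>
      intro hi
      obtain ⟨k, hk, hks⟩ := ih (by omega)
      refine advance _ _ k (by positivity) (by gcongr; simp) ?_ ?_ hk hks
      · have : ((i + 1 : ℕ) : ℝ) ≤ n := by exact_mod_cast hi
        calc ((i + 1 : ℕ) : ℝ) * (l / n) ≤ n * (l / n) := by gcongr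
          _ = l := by field_simp
      · push_cast
        linarith
  obtain ⟨k, hk, hkl⟩ := walk n le_rfl
  rw [mul_div_cancel₀ _ hn0.ne'] at hkl
  have hend : γ l = g x := (dist_eq_zero.1 (by rw [(hends l hl0 le_rfl).2, sub_self])).symm
  have hkg := hkl g hg
  rw [hend, dist_self] at hkg
  by_cases hkeq : k = g
  · exact hkeq ▸ hk
  · linarith [two_mul_le_dist_orbit hinj hg (hk.mem hS.subset) hkeq]
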